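/- Let $\mathcal P$ be a finite family of pairwise disjoint simple polygons in the plane (closed regions bounded by simple closed polygonal curves) such that no three distinct vertices lie on a common line. For $\mathcal S\subseteq\mathcal P$ let $\mathrm{CH}(\mathcal S)$ be the convex hull of $\bigcup\mathcal S$. *Definitions.* $\mathcal S$ is *tight* if there is no line that misses all polygons of $\mathcal S$ and has polygons of $\mathcal S$ on both sides. $\mathcal S$ is *bridgeable by* a finite set $\Sigma$ of closed segments with pairwise disjoint relative interiors if: $\bigcup\mathcal S\cup\bigcup\Sigma$ is connected; the relative interiors of the segments of $\Sigma$ are disjoint from the interiors of the polygons of $\mathcal P$; every polygon of $\mathcal P$ that meets a segment of $\Sigma$ belongs to $\mathcal S$; every segment of $\Sigma$ has an endpoint on the boundary of a polygon of $\mathcal S$; and every segment of $\Sigma$ lies in $\mathrm{CH}(\mathcal S)$. $\mathcal S$ is *bridgeable* if it is bridgeable by some $\Sigma$. A partition of $\mathcal P$ is *proper* if all its sets are tight and bridgeable. Bridgeable sets $\mathcal S_1,\mathcal S_2$ are *compatible* if they are disjoint, they are bridgeable by some $\Sigma_1$, $\Sigma_2$ such that every segment of $\Sigma_1$ is disjoint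 from every segment of $\Sigma_2$, and $\mathcal S_1\cup\mathcal S_2$ is bridgeable. *Algorithm (main stage).* It maintains a partition of $\mathcal P$, initially into singletons; a scene, initially the polygons; and a FIFO queue of edges, initially the edges of the hulls $\mathrm{CH}(\{P\})$, $P\in\mathcal P$, that are not edges of $P$ (in any order). While the queue is non-empty, it pops its front edge, calls the endpoints $p_1\in P_1$ and $p_2\in P_2$ (in either order; $P_1,P_2\in\mathcal P$), and shoots a ray from $p_1$ towards $p_2$ up to the first point $h\ne p_1$ of the scene. The label $P$ of what is hit is $P_2$ if $h=p_2$, and otherwise a polygon containing $h$ or the label of an earlier shot segment containing $h$. The segment $p_1h$ is added to the scene with label $P_1$. If the sets $X\ni P_1$ and $X'\ni P$ of the partition are different, they are replaced by $X\cup X'$, and the edges of $\mathrm{CH}(X\cup X')$ that are edges neither of $\mathrm{CH}(X)$ nor of $\mathrm{CH}(X')$ are appended to the queue (in any order). *Statement.* Let $\Pi_0,\Pi_1,\dots,\Pi_m$ be the partitions computed by the algorithm up to its $m$-th merge, where $\mathcal S_t,\mathcal S_t'\in\Pi_t$ are the two sets merged to obtain $\Pi_{t+1}$, for $t=0,\dots,m-1$.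 Then for every $t<m$: (A) $\mathrm{CH}(\mathcal S_t)$ intersects $\mathrm{CH}(\mathcal S_t')$; (B) $\mathcal S_t$ and $\mathcal S_t'$ are compatible; (C) $\Pi_{t+1}$ is proper. Moreover $\Pi_0$ is proper, and for every $t\le m$, at the moment when $\Pi_t$ appears, every $\mathcal S\in\Pi_t$ is bridgeable by the set of the segments shot so far whose label belongs to $\mathcal S$. -/

import Mathlib

namespace Convexify

/-- The Euclidean plane. -/
abbrev Plane := EuclideanSpace ℝ (Fin 2)

/-- A simple polygon, given by the cyclic sequence of its vertices: the half-open edges, run through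
one after another, form an injective closed curve. -/
structure SimplePolygon where
  n : ℕ
  three_le : 3 ≤ n
  poly : Polygon Plane n
  simple : ∀ i j : Fin n, ∀ s ∈ Set.Ico (0 : ℝ) 1, ∀ t ∈ Set.Ico (0 : ℝ) 1,
    poly.edgePath ℝ i s = poly.edgePath ℝ j t → i = j ∧ s = t

namespace SimplePolygon

/-- The boundary curve, the union of the edges. -/
def boundary (Q : SimplePolygon) : Set Plane := Q.poly.boundary ℝ

/-- The closed region bounded by the boundary curve: the curve together with the bounded
components of its complement. -/
def region (Q : SimplePolygon) : Set Plane :=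
  Q.boundary ∪ {x | x ∉ Q.boundary ∧ Bornology.IsBounded (connectedComponentIn Q.boundaryᶜ x)}

/-- The set of vertices. -/
def vertexSet (Q : SimplePolygon) : Set Plane := Set.range Q.poly.vertices

/-- The points `p`, `q` are the endpoints of an edge of the polygon. -/
def IsEdge (Q : SimplePolygon) (p q : Plane) : Prop :=
  ∃ i : Fin Q.n, s(p, q) = s(Q.poly.vertices i, Q.poly.vertices (finRotate Q.n i))

end SimplePolygon

section Geometry

variable {ι : Type*} (P : ι → SimplePolygon)

/-- No three distinct vertices of the polygons lie on a common line. -/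
def GeneralPosition : Prop :=
  ∀ a ∈ ⋃ i, (P i).vertexSet, ∀ b ∈ ⋃ i, (P i).vertexSet, ∀ c ∈ ⋃ i, (P i).vertexSet,
    a ≠ b → a ≠ c → b ≠ c → ¬ Collinear ℝ {a, b, c}

/-- The union of the polygons with index in `S`. -/
def polyUnion (S : Set ι) : Set Plane := ⋃ i ∈ S, (P i).region

/-- The combined convex hull of the polygons with index in `S`. -/
def hull (S : Set ι) : Set Plane := convexHull ℝ (polyUnion P S)

/-- Some line `{x | ⟪a, x⟫ = c}` misses all polygons of `S` and has polygons of `S` on both sides. -/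
def Separable (S : Set ι) : Prop :=
  ∃ (a : Plane) (c : ℝ), a ≠ 0 ∧ (∀ i ∈ S, ∀ x ∈ (P i).region, inner ℝ a x ≠ c) ∧
    (∃ i ∈ S, ∀ x ∈ (P i).region, inner ℝ a x < c) ∧
    (∃ j ∈ S, ∀ x ∈ (P j).region, c < inner ℝ a x)

/-- A set of polygons is tight if it is not separable. -/
def Tight (S : Set ι) : Prop := ¬ Separable P S

/-- The set `S` of polygons is bridgeable by the finite set `B` of closed segments; a segment is
given by the pair of its endpoints. -/
structure BridgeableBy (S : Set ι) (B : Set (Plane × Plane)) : Prop where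
  finite : B.Finite
  nondegenerate : ∀ b ∈ B, b.1 ≠ b.2
  interior_disjoint : B.Pairwise fun b c =>
    Disjoint (openSegment ℝ b.1 b.2) (openSegment ℝ c.1 c.2)
  connected : IsConnected (polyUnion P S ∪ ⋃ b ∈ B, segment ℝ b.1 b.2)
  interior_disjoint_polygon : ∀ b ∈ B, ∀ i,
    Disjoint (openSegment ℝ b.1 b.2) (interior (P i).region)
  mem_of_meets : ∀ b ∈ B, ∀ i, (segment ℝ b.1 b.2 ∩ (P i).region).Nonempty → i ∈ S
  endpoint : ∀ b ∈ B, ∃ i ∈ S, b.1 ∈ (P i).boundary ∨ b.2 ∈ (P i).boundary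
  subset_hull : ∀ b ∈ B, segment ℝ b.1 b.2 ⊆ hull P S

/-- The set `S` of polygons is bridgeable by some set of segments. -/
def Bridgeable (S : Set ι) : Prop := ∃ B, BridgeableBy P S B

/-- A partition of the polygons is proper if all its sets are tight and bridgeable. -/
def Proper (part : Set (Set ι)) : Prop :=
  Setoid.IsPartition part ∧ ∀ S ∈ part, Tight P S ∧ Bridgeable P S

/-- Compatibility of two bridgeable sets of polygons. -/
def Compatible (S T : Set ι) : Prop :=
  Disjoint S T ∧
  (∃ B C, BridgeableBy P S B ∧ BridgeableBy P T C ∧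
    ∀ b ∈ B, ∀ c ∈ C, Disjoint (segment ℝ b.1 b.2) (segment ℝ c.1 c.2)) ∧
  Bridgeable P (S ∪ T)

end Geometry

/-- The points `p`, `q` are the endpoints of an edge (a one-dimensional face) of the convex polygon
`K`. -/
def IsHullEdge (K : Set Plane) (p q : Plane) : Prop :=
  p ≠ q ∧ IsExtreme ℝ K (segment ℝ p q)

/-- The trace of a ray: the ray started at the vertex `src` of the polygon `label` and stopped
at `dst`. -/
structure Trace (ι : Type*) where
  src : Plane
  dst : Plane
  label : ι

/-- A state of the main loop: the current partition of the polygons (the union-find structure; the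
maintained convex polygons are the hulls of its sets), the traces inserted into the scene so far,
and the queue of edges that are still to be traced. -/
structure State (ι : Type*) where
  part : Set (Set ι)
  traces : Set (Trace ι)
  queue : List (Sym2 Plane)

/-- The segments traced by the rays that were shot from polygons of `S`. -/
def State.segmentsOf {ι : Type*} (s : State ι) (S : Set ι) : Set (Plane × Plane) :=
  {b | ∃ τ ∈ s.traces, τ.label ∈ S ∧ b = (τ.src, τ.dst)}

section Algorithm

variable {ι : Type*} (P : ι → SimplePolygon)

/-- The scene of the ray shooting structure: the polygons and the traces of the earlier rays. -/
def scene (s : State ι) : Set Plane :=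
  (⋃ i, (P i).region) ∪ ⋃ τ ∈ s.traces, segment ℝ τ.src τ.dst

/-- The initial states: singletons, no traces, and a queue that lists (in any order, each once) the
edges of the convex hulls of the single polygons that are not edges of the polygon itself. -/
structure IsInitial (s : State ι) : Prop where
  part_eq : s.part = Set.range fun i => ({i} : Set ι)
  traces_eq : s.traces = ∅
  queue_nodup : s.queue.Nodup
  mem_queue : ∀ p q, s(p, q) ∈ s.queue ↔ ∃ i, IsHullEdge (hull P {i}) p q ∧ ¬ (P i).IsEdge p q

/-- In state `s`, the ray shot from the point `p` of the polygon `i` towards `q` stops at `h`, and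
the entity it hits carries the label `k`: this is the polygon of `q` if the ray arrives at `q`;
otherwise it is a polygon containing `h` or the label of an older trace through `h`. -/
structure Shoots (s : State ι) (p q h : Plane) (i k : ι) : Prop where
  source : p ∈ (P i).region
  mem_segment : h ∈ segment ℝ p q
  ne_source : h ≠ p
  clear : Disjoint (openSegment ℝ p h) (scene P s)
  hit : (h = q ∧ q ∈ (P k).region) ∨
    (h ≠ q ∧ (h ∈ (P k).region ∨
      ∃ τ ∈ s.traces, h ∈ segment ℝ τ.src τ.dst ∧ τ.label = k))

/-- One iteration without a merge: the edge at the front of the queue is popped, a ray is shot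
along it from one of its endpoints, its trace is inserted, and it hit its own component. -/
def IdleStep (s s' : State ι) : Prop :=
  ∃ (p q h : Plane) (i k : ι) (rest : List (Sym2 Plane)),
    s.queue = s(p, q) :: rest ∧ Shoots P s p q h i k ∧
    (∃ X ∈ s.part, i ∈ X ∧ k ∈ X) ∧
    s' = ⟨s.part, insert ⟨p, h, i⟩ s.traces, rest⟩

/-- One iteration in which a ray shot from the component `X` hits the different component `X'`: the
two are merged, and the new edges of the new convex hull are pushed (in any order, each once). -/
def MergeStep (s : State ι) (X X' : Set ι) (s' : State ι) : Prop :=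
  ∃ (p q h : Plane) (i k : ι) (rest new : List (Sym2 Plane)),
    s.queue = s(p, q) :: rest ∧ Shoots P s p q h i k ∧
    X ∈ s.part ∧ X' ∈ s.part ∧ i ∈ X ∧ k ∈ X' ∧ X ≠ X' ∧
    new.Nodup ∧
    (∀ a b, s(a, b) ∈ new ↔ IsHullEdge (hull P (X ∪ X')) a b ∧
      ¬ IsHullEdge (hull P X) a b ∧ ¬ IsHullEdge (hull P X') a b) ∧
    s' = ⟨(s.part \ {X, X'}) ∪ {X ∪ X'}, insert ⟨p, h, i⟩ s.traces, rest ++ new⟩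

/-- An execution of the main loop up to its `m`-th merge. The state `start t` is the one in which
the `t`-th partition appears; then come iterations without a merge up to the state `finish t`, and
then the iteration that merges the sets `left t` and `right t`. The values at times beyond `m` are
irrelevant. -/
structure Execution (m : ℕ) where
  start : ℕ → State ι
  finish : ℕ → State ι
  left : ℕ → Set ι
  right : ℕ → Set ι
  initial : IsInitial P (start 0)
  idle : ∀ t < m, Relation.ReflTransGen (IdleStep P) (start t) (finish t)
  merge : ∀ t < m, MergeStep P (finish t) (left t) (right t) (start (t + 1))

/-- The `t`-th partition of the sequence that the execution computes. -/
def Execution.partition {P : ι → SimplePolygon} {m : ℕ} (E : Execution P m) (t : ℕ) :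
    Set (Set ι) := (E.start t).part

end Algorithm

end Convexify

open Convexify

/-! The proof is an induction over the iterations with one invariant, `Invariant`: parts are tight,
each part is bridged by its own traces, traces of different parts are disjoint, and each queued edge
is a hull edge of a subset of some part.

Consider a ray from `p` in polygon `i` of the part `X`, stopped at `h`, with label `k` in the part
`X'`. The queued edge is an edge of the hull of some `T`. Its endpoint `p` is extreme there, so `p`
lies on the boundary of a polygon of `T`; that polygon is `i`, hence `T` is contained in `X` and the
trace stays in the hull of `X` (`Shoots.segment_subset_hull`). The point `h` lies on a polygon or a
trace of `X'`, hence in the hull of `X'`. So the hulls meet, which makes the union tight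
(`Tight.union`), and the trace connects the two bridged unions. Its relative interior avoids the
scene, so only `p` and `h` can touch older objects, and those belong to `X` or `X'`
(`Shoots.bridgeableBy_union`, `Shoots.disjoint_segment`).

An idle iteration is the case `X = X'`, so `Shoots.invariant_merge` covers both kinds of step. -/

namespace Convexify

open Set

/-! ### Topology of polygonal regions: closedness of the boundary, connectedness of the region. -/

namespace SimplePolygon

variable (Q : SimplePolygon)

theorem boundary_eq_iUnion_segment :
    Q.boundary = ⋃ i, segment ℝ (Q.poly.vertices i) (Q.poly.vertices (finRotate Q.n i)) := by
  simp only [boundary, Polygon.boundary, Polygon.edgeSet, affineSegment_eq_segment]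

theorem isClosed_boundary : IsClosed Q.boundary := by
  rw [boundary_eq_iUnion_segment]
  refine isClosed_iUnion_of_finite fun i => ?_
  rw [segment_eq_image_lineMap]
  exact (isCompact_Icc.image AffineMap.lineMap_continuous).isClosed

theorem isConnected_boundary : IsConnected Q.boundary := by
  rw [boundary_eq_iUnion_segment]
  obtain ⟨n, hn, poly, hs⟩ := Q
  obtain ⟨m, rfl⟩ : ∃ m, n = m + 1 := ⟨n - 1, by omega⟩
  dsimp only
  set R := fun i j : Fin (m + 1) =>
    (segment ℝ (poly.vertices i) (poly.vertices (finRotate (m + 1) i)) ∩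
      segment ℝ (poly.vertices j) (poly.vertices (finRotate (m + 1) j))).Nonempty with hR
  have hsymm : Std.Symm R := ⟨fun i j h => by simpa only [hR, inter_comm] using h⟩
  -- Consecutive edges share a vertex, so all edges are reached from edge `0`; the closing adjacency
  -- is not needed.
  have hzero : ∀ j, Relation.ReflTransGen R 0 j := by
    intro j
    induction j using Fin.induction with
    | zero => exact .refl
    | succ j ih =>
      refine ih.tail ⟨poly.vertices j.succ, ?_, left_mem_segment ℝ _ _⟩
      have : finRotate (m + 1) j.castSucc = j.succ := by simp
      rw [this]
      exact right_mem_segment ℝ _ _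
  refine IsConnected.iUnion_of_reflTransGen
    (fun i => ⟨⟨_, left_mem_segment ℝ _ _⟩, (convex_segment _ _).isPreconnected⟩) fun i j => ?_
  exact (Relation.ReflTransGen.stdSymm.symm _ _ (hzero i)).trans (hzero j)

theorem boundary_subset_region : Q.boundary ⊆ Q.region := subset_union_left

theorem component_subset_region {x : Plane} (hx : x ∈ Q.region) :
    connectedComponentIn Q.boundaryᶜ x ⊆ Q.region := by
  rcases hx with hx | ⟨-, hb⟩
  · rw [connectedComponentIn_eq_empty (by simpa using hx)]
    exact empty_subset _
  · intro y hy
    refine Or.inr ⟨connectedComponentIn_subset _ _ hy, ?_⟩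
    rwa [← connectedComponentIn_eq hy]

theorem mem_boundary_or_mem_interior {x : Plane} (hx : x ∈ Q.region) :
    x ∈ Q.boundary ∨ x ∈ interior Q.region := by
  by_cases hb : x ∈ Q.boundary
  · exact Or.inl hb
  · exact Or.inr (mem_interior.2 ⟨_, Q.component_subset_region hx,
      Q.isClosed_boundary.isOpen_compl.connectedComponentIn, mem_connectedComponentIn hb⟩)

/-- A bounded component of the complement of the boundary has a limit point on the boundary. -/
theorem exists_mem_closure_component {x : Plane} (hx : x ∉ Q.boundary)
    (hb : Bornology.IsBounded (connectedComponentIn Q.boundaryᶜ x)) :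
    ∃ y ∈ Q.boundary, y ∈ closure (connectedComponentIn Q.boundaryᶜ x) := by
  set C := connectedComponentIn Q.boundaryᶜ x with hC
  have hopen : IsOpen C := Q.isClosed_boundary.isOpen_compl.connectedComponentIn
  have hne : C.Nonempty := ⟨x, mem_connectedComponentIn hx⟩
  have hne_univ : C ≠ univ := fun h => NormedSpace.unbounded_univ ℝ Plane (h ▸ hb)
  obtain ⟨y, hy⟩ : (frontier C).Nonempty := by
    rw [nonempty_iff_ne_empty]
    intro h
    rcases isClopen_iff.1 (isClopen_iff_frontier_eq_empty.2 h) with h | h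
    · exact hne.ne_empty h
    · exact hne_univ h
  refine ⟨y, ?_, hy.1⟩
  by_contra hyb
  -- Off the boundary, `y` has its own open component. It meets `C`, so it equals `C`, and `y` would
  -- be interior to `C`.
  obtain ⟨z, hzy, hzC⟩ := mem_closure_iff.1 hy.1 _
    (Q.isClosed_boundary.isOpen_compl.connectedComponentIn (x := y))
    (mem_connectedComponentIn hyb)
  have hyC : y ∈ C := by
    rw [hC, connectedComponentIn_eq hzC, ← connectedComponentIn_eq hzy]
    exact mem_connectedComponentIn hyb
  exact hy.2 (hopen.interior_eq.symm ▸ hyC)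

theorem isConnected_region : IsConnected Q.region := by
  obtain ⟨a, ha⟩ := Q.isConnected_boundary.nonempty
  refine ⟨⟨a, Q.boundary_subset_region ha⟩, isPreconnected_of_forall a fun x hx => ?_⟩
  rcases id hx with hxb | ⟨hxb, hbdd⟩
  · exact ⟨Q.boundary, Q.boundary_subset_region, ha, hxb, Q.isConnected_boundary.isPreconnected⟩
  obtain ⟨y, hyb, hyC⟩ := Q.exists_mem_closure_component hxb hbdd
  refine ⟨Q.boundary ∪ insert y (connectedComponentIn Q.boundaryᶜ x), ?_, Or.inl ha,
    Or.inr (Or.inr (mem_connectedComponentIn hxb)), ?_⟩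
  · exact union_subset Q.boundary_subset_region
      (insert_subset (Q.boundary_subset_region hyb) (Q.component_subset_region hx))
  · refine Q.isConnected_boundary.isPreconnected.union y hyb (mem_insert _ _) ?_
    exact isPreconnected_connectedComponentIn.subset_closure (subset_insert _ _)
      (insert_subset hyC subset_closure)

end SimplePolygon

/-! ### Extreme points and hull edges. -/

/-- The endpoints of an edge of a set are extreme points of the set. -/
theorem IsHullEdge.left_mem_extremePoints {K : Set Plane} {p q : Plane} (h : IsHullEdge K p q) :
    p ∈ K.extremePoints ℝ := by
  refine h.2.extremePoints_subset_extremePoints ⟨left_mem_segment ℝ p q, ?_⟩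
  rintro x hx y hy hp
  rw [segment_eq_image_lineMap] at hx hy
  obtain ⟨s, hs, rfl⟩ := hx
  obtain ⟨t, ht, rfl⟩ := hy
  rw [openSegment_eq_image_lineMap] at hp
  obtain ⟨u, hu, hup⟩ := hp
  -- In the parameter of the segment, `p` is `0` and is a positively weighted mean of `s` and `t`,
  -- both nonnegative; this forces `s = 0`.
  have key : AffineMap.lineMap p q (AffineMap.lineMap s t u : ℝ) =
      AffineMap.lineMap p q (0 : ℝ) := by
    rw [AffineMap.apply_lineMap, hup, AffineMap.lineMap_apply_zero]
  have h0 := AffineMap.lineMap_injective ℝ h.1 key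
  rw [AffineMap.lineMap_apply_module, smul_eq_mul, smul_eq_mul] at h0
  have : s = 0 := by
    have h1 : 0 < 1 - u := by linarith [hu.2]
    have h2 : 0 ≤ u * t := mul_nonneg hu.1.le ht.1
    have h3 : 0 ≤ (1 - u) * s := mul_nonneg h1.le hs.1
    have h4 : (1 - u) * s = 0 := by linarith
    exact (mul_eq_zero.1 h4).resolve_left h1.ne'
  simp [this]

/-- An interior point is the midpoint of a short segment inside `K`. -/
theorem notMem_interior_of_mem_extremePoints {K : Set Plane} {p : Plane}
    (hp : p ∈ K.extremePoints ℝ) : p ∉ interior K := by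
  intro hi
  obtain ⟨v, hv⟩ := exists_ne (0 : Plane)
  have hlim : ∀ w : Plane, ∀ᶠ r : ℝ in nhds 0, p + r • w ∈ K := by
    intro w
    have hc : ContinuousAt (fun r : ℝ => p + r • w) 0 := by fun_prop
    exact hc.eventually (by simpa using mem_interior_iff_mem_nhds.1 hi)
  have hev : ∀ᶠ r : ℝ in nhdsWithin 0 (Ioi 0), p + r • v ∈ K ∧ p + r • (-v) ∈ K :=
    nhdsWithin_le_nhds ((hlim v).and (hlim (-v)))
  obtain ⟨r, ⟨h1, h2⟩, hr⟩ := (hev.and self_mem_nhdsWithin).exists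
  have hmid : p ∈ openSegment ℝ (p + r • v) (p + r • (-v)) := by
    refine ⟨1 / 2, 1 / 2, by norm_num, by norm_num, by norm_num, ?_⟩
    module
  have := hp.2 h1 h2 hmid
  have hz : r • v = 0 := by simpa using this
  exact (smul_ne_zero (ne_of_gt hr) hv) hz

/-! ### Hulls, tightness and merging of partitions. -/

section Geometry

variable {ι : Type*} {P : ι → SimplePolygon}

theorem region_subset_polyUnion {S : Set ι} {i : ι} (hi : i ∈ S) :
    (P i).region ⊆ polyUnion P S :=
  subset_biUnion_of_mem (u := fun i => (P i).region) hi

theorem region_subset_hull {S : Set ι} {i : ι} (hi : i ∈ S) : (P i).region ⊆ hull P S :=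
  (region_subset_polyUnion hi).trans (subset_convexHull ℝ _)

theorem hull_mono {S T : Set ι} (h : S ⊆ T) : hull P S ⊆ hull P T :=
  convexHull_mono (biUnion_subset_biUnion_left h)

theorem polyUnion_union (S T : Set ι) : polyUnion P (S ∪ T) = polyUnion P S ∪ polyUnion P T :=
  biUnion_union _ _ _

theorem index_unique (hdisj : Pairwise fun i j => Disjoint (P i).region (P j).region)
    {i j : ι} {x : Plane} (hi : x ∈ (P i).region) (hj : x ∈ (P j).region) : i = j := by
  by_contra h
  exact disjoint_left.1 (hdisj h) hi hj

/-- An endpoint of a hull edge is on the boundary of the polygon that contains it, and this polygon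
is one of those that span the hull. -/
theorem IsHullEdge.mem_boundary (hdisj : Pairwise fun i j => Disjoint (P i).region (P j).region)
    {S : Set ι} {p q : Plane} (h : IsHullEdge (hull P S) p q) {i : ι} (hi : p ∈ (P i).region) :
    i ∈ S ∧ p ∈ (P i).boundary := by
  have hp := h.left_mem_extremePoints
  obtain ⟨j, hj, hpj⟩ := mem_iUnion₂.1 (extremePoints_convexHull_subset hp)
  obtain rfl := index_unique hdisj hi hpj
  refine ⟨hj, ((P i).mem_boundary_or_mem_interior hi).resolve_right fun hint => ?_⟩
  exact notMem_interior_of_mem_extremePoints hp (interior_mono (region_subset_hull hj) hint)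

theorem tight_singleton (i : ι) : Tight P {i} := by
  rintro ⟨a, c, -, -, ⟨j, rfl, hj⟩, ⟨k, rfl, hk⟩⟩
  obtain ⟨x, hx⟩ := (P k).isConnected_region.nonempty
  exact lt_asymm (hj x hx) (hk x hx)

/-- A line that misses a connected set leaves it on one side. -/
theorem lt_or_gt_of_forall_inner_ne {s : Set Plane} (hs : IsPreconnected s) {a : Plane} {c : ℝ}
    (h : ∀ x ∈ s, inner ℝ a x ≠ c) :
    (∀ x ∈ s, inner ℝ a x < c) ∨ (∀ x ∈ s, c < inner ℝ a x) := by
  by_contra! hcon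
  obtain ⟨⟨x, hx, hxc⟩, ⟨y, hy, hyc⟩⟩ := hcon
  obtain ⟨z, hz, hzc⟩ := hs.intermediate_value hy hx
    (f := fun x => inner ℝ a x) (by fun_prop) ⟨hyc, hxc⟩
  exact h z hz hzc

/-- A line that misses the polygons of a tight set leaves their hull on one side. -/
theorem Tight.hull_subset {S : Set ι} (hS : Tight P S) {a : Plane} {c : ℝ} (ha : a ≠ 0)
    (h : ∀ i ∈ S, ∀ x ∈ (P i).region, inner ℝ a x ≠ c) :
    (∀ x ∈ hull P S, inner ℝ a x < c) ∨ (∀ x ∈ hull P S, c < inner ℝ a x) := by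
  have hside : ∀ i ∈ S, (∀ x ∈ (P i).region, inner ℝ a x < c) ∨
      (∀ x ∈ (P i).region, c < inner ℝ a x) := fun i hi =>
    lt_or_gt_of_forall_inner_ne (P i).isConnected_region.isPreconnected (h i hi)
  have hlin : IsLinearMap ℝ fun x : Plane => inner ℝ a x :=
    ⟨fun x y => inner_add_right a x y, fun r x => inner_smul_right a x r⟩
  by_cases hlt : ∃ i ∈ S, ∀ x ∈ (P i).region, inner ℝ a x < c
  · refine Or.inl (convexHull_min ?_ (convex_halfSpace_lt hlin c))
    refine iUnion₂_subset fun j hj => (hside j hj).resolve_right fun hgt => ?_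
    exact hS ⟨a, c, ha, h, hlt, j, hj, hgt⟩
  · refine Or.inr (convexHull_min ?_ (convex_halfSpace_gt hlin c))
    exact iUnion₂_subset fun j hj => (hside j hj).resolve_left fun hj' => hlt ⟨j, hj, hj'⟩

/-- A line missing all polygons leaves each of the two hulls on one side. A common point puts both
hulls on the same side, so no polygon is left for the other. -/
theorem Tight.union {S T : Set ι} (hS : Tight P S) (hT : Tight P T)
    (hST : (hull P S ∩ hull P T).Nonempty) : Tight P (S ∪ T) := by
  rintro ⟨a, c, ha, hmiss, ⟨i, hi, hlt⟩, ⟨j, hj, hgt⟩⟩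
  obtain ⟨x, hxS, hxT⟩ := hST
  obtain ⟨y, hy⟩ := (P i).isConnected_region.nonempty
  obtain ⟨z, hz⟩ := (P j).isConnected_region.nonempty
  have hyc := hlt y hy
  have hzc := hgt z hz
  rcases hS.hull_subset ha fun i hi => hmiss i (Or.inl hi) with h | h <;>
    rcases hT.hull_subset ha fun i hi => hmiss i (Or.inr hi) with h' | h'
  · rcases hj with hj | hj
    · exact lt_asymm hzc (h z (region_subset_hull hj hz))
    · exact lt_asymm hzc (h' z (region_subset_hull hj hz))
  · exact lt_asymm (h x hxS) (h' x hxT)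
  · exact lt_asymm (h x hxS) (h' x hxT)
  · rcases hi with hi | hi
    · exact lt_asymm hyc (h y (region_subset_hull hi hy))
    · exact lt_asymm hyc (h' y (region_subset_hull hi hy))

theorem bridgeableBy_singleton (i : ι) : BridgeableBy P {i} ∅ where
  finite := finite_empty
  nondegenerate := by simp
  interior_disjoint := by simp
  connected := by simpa [polyUnion] using (P i).isConnected_region
  interior_disjoint_polygon := by simp
  mem_of_meets := by simp
  endpoint := by simp
  subset_hull := by simp

theorem isPartition_range_singleton :
    Setoid.IsPartition (range fun i : ι => ({i} : Set ι)) := by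
  refine ⟨by simp, fun i => ⟨{i}, ⟨⟨i, rfl⟩, rfl⟩, ?_⟩⟩
  rintro _ ⟨⟨j, rfl⟩, hj⟩
  rw [mem_singleton_iff.1 hj]

theorem eq_of_mem_partition {c : Set (Set ι)} (hc : Setoid.IsPartition c) {S T : Set ι}
    (hS : S ∈ c) (hT : T ∈ c) {i : ι} (hiS : i ∈ S) (hiT : i ∈ T) : S = T :=
  Setoid.eq_of_mem_eqv_class hc.2 hS hiS hT hiT

/-- The case `S = T` is allowed, so that idle iterations count as merges. -/
theorem isPartition_merge {c : Set (Set ι)} (hc : Setoid.IsPartition c) {S T : Set ι}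
    (hS : S ∈ c) (hT : T ∈ c) : Setoid.IsPartition ((c \ {S, T}) ∪ {S ∪ T}) := by
  constructor
  · rintro (h | h)
    · exact hc.1 h.1
    · obtain ⟨i, hi⟩ := Setoid.nonempty_of_mem_partition hc hS
      exact (h.symm ▸ notMem_empty i) (Or.inl hi : i ∈ S ∪ T)
  · intro i
    obtain ⟨U, ⟨hU, hiU⟩, -⟩ := hc.2 i
    by_cases hi : i ∈ S ∪ T
    · refine ⟨S ∪ T, ⟨Or.inr rfl, hi⟩, ?_⟩
      rintro V ⟨⟨hV, hVne⟩ | hV, hiV⟩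
      · refine absurd ?_ hVne
        exact hi.imp (eq_of_mem_partition hc hV hS hiV) (eq_of_mem_partition hc hV hT hiV)
      · exact hV
    · refine ⟨U, ⟨Or.inl ⟨hU, ?_⟩, hiU⟩, ?_⟩
      · rintro (rfl | rfl)
        exacts [hi (Or.inl hiU), hi (Or.inr hiU)]
      · rintro V ⟨⟨hV, -⟩ | rfl, hiV⟩
        exacts [eq_of_mem_partition hc hV hU hiV hiU, absurd hiV hi]

end Geometry

/-! ### The loop invariant. -/

section Algorithm

variable {ι : Type*} {P : ι → SimplePolygon}

/-- The loop invariant: the sets of the partition are tight and bridged by their own traces, the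
traces of different sets are disjoint, and every edge in the queue is an edge of the hull of a
subset of some set of the partition. -/
structure Invariant (P : ι → SimplePolygon) (s : State ι) : Prop where
  isPartition : Setoid.IsPartition s.part
  tight : ∀ S ∈ s.part, Tight P S
  bridgeableBy : ∀ S ∈ s.part, BridgeableBy P S (s.segmentsOf S)
  disjoint : ∀ S ∈ s.part, ∀ T ∈ s.part, S ≠ T → ∀ b ∈ s.segmentsOf S, ∀ c ∈ s.segmentsOf T,
    Disjoint (segment ℝ b.1 b.2) (segment ℝ c.1 c.2)
  -- A queued edge may outlive merges of its set, hence a subset `T` of a current part. Both orders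
  -- of the endpoints are covered, since the ray may start at either.
  hullEdge : ∀ p q, s(p, q) ∈ s.queue → ∃ S ∈ s.part, ∃ T ⊆ S, IsHullEdge (hull P T) p q

theorem IsInitial.invariant {s : State ι} (h : IsInitial P s) : Invariant P s := by
  have hseg : ∀ S, s.segmentsOf S = ∅ := fun S => by simp [State.segmentsOf, h.traces_eq]
  refine ⟨h.part_eq ▸ isPartition_range_singleton, ?_, ?_, ?_, ?_⟩
  · rw [h.part_eq]
    rintro _ ⟨i, rfl⟩
    exact tight_singleton i
  · rw [h.part_eq]
    rintro _ ⟨i, rfl⟩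
    rw [hseg]
    exact bridgeableBy_singleton i
  · intro S _ T _ _ b hb
    rw [hseg] at hb
    exact hb.elim
  · intro p q hpq
    obtain ⟨i, hi, -⟩ := (h.mem_queue p q).1 hpq
    exact ⟨{i}, h.part_eq ▸ ⟨i, rfl⟩, {i}, Subset.rfl, hi⟩

theorem segmentsOf_insert_of_mem {part : Set (Set ι)} {traces : Set (Trace ι)}
    {queue : List (Sym2 Plane)} {p h : Plane} {i : ι} {S : Set ι} (hi : i ∈ S) :
    (State.mk part (insert ⟨p, h, i⟩ traces) queue).segmentsOf S =
      insert (p, h) {b | ∃ τ ∈ traces, τ.label ∈ S ∧ b = (τ.src, τ.dst)} := by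
  ext b
  simp [State.segmentsOf, hi]

theorem segmentsOf_insert_of_notMem {part : Set (Set ι)} {traces : Set (Trace ι)}
    {queue : List (Sym2 Plane)} {p h : Plane} {i : ι} {S : Set ι} (hi : i ∉ S) :
    (State.mk part (insert ⟨p, h, i⟩ traces) queue).segmentsOf S =
      {b | ∃ τ ∈ traces, τ.label ∈ S ∧ b = (τ.src, τ.dst)} := by
  ext b
  simp [State.segmentsOf, hi]

theorem segmentsOf_union (s : State ι) (S T : Set ι) :
    s.segmentsOf (S ∪ T) = s.segmentsOf S ∪ s.segmentsOf T := by
  ext b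
  simp only [State.segmentsOf, mem_ofPred_eq, mem_union]
  constructor
  · rintro ⟨τ, hτ, h | h, hb⟩
    exacts [Or.inl ⟨τ, hτ, h, hb⟩, Or.inr ⟨τ, hτ, h, hb⟩]
  · rintro (⟨τ, hτ, h, hb⟩ | ⟨τ, hτ, h, hb⟩)
    exacts [⟨τ, hτ, Or.inl h, hb⟩, ⟨τ, hτ, Or.inr h, hb⟩]

theorem segmentsOf_subset_scene {s : State ι} {S : Set ι} {b : Plane × Plane}
    (hb : b ∈ s.segmentsOf S) : segment ℝ b.1 b.2 ⊆ scene P s := by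
  obtain ⟨τ, hτ, -, rfl⟩ := hb
  exact (subset_biUnion_of_mem (u := fun τ : Trace ι => segment ℝ τ.src τ.dst) hτ).trans
    subset_union_right

theorem region_subset_scene (s : State ι) (i : ι) : (P i).region ⊆ scene P s :=
  (subset_iUnion (fun i => (P i).region) i).trans subset_union_left

/-! ### The effect of a single ray. -/

namespace Shoots

variable {s : State ι} {p q h : Plane} {i k : ι} {X X' : Set ι}

/-- The point that is hit belongs to a polygon or to a trace of the set that is hit. -/
theorem mem_bridged (hs : Shoots P s p q h i k) (hk : k ∈ X') :
    h ∈ polyUnion P X' ∪ ⋃ b ∈ s.segmentsOf X', segment ℝ b.1 b.2 := by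
  rcases hs.hit with ⟨rfl, hq⟩ | ⟨-, hh | ⟨τ, hτ, hh, rfl⟩⟩
  · exact Or.inl (region_subset_polyUnion hk hq)
  · exact Or.inl (region_subset_polyUnion hk hh)
  · exact Or.inr (mem_biUnion (⟨τ, hτ, hk, rfl⟩ : (τ.src, τ.dst) ∈ s.segmentsOf X') hh)

theorem mem_hull (hs : Shoots P s p q h i k) (hX' : BridgeableBy P X' (s.segmentsOf X'))
    (hk : k ∈ X') : h ∈ hull P X' := by
  rcases hs.mem_bridged hk with hh | hh
  · exact subset_convexHull ℝ _ hh
  · obtain ⟨b, hb, hhb⟩ := mem_iUnion₂.1 hh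
    exact hX'.subset_hull b hb hhb

/-- The trace lies in the hull of the set from which the ray was shot. -/
theorem segment_subset_hull (hdisj : Pairwise fun i j => Disjoint (P i).region (P j).region)
    (hs : Shoots P s p q h i k) (hinv : Invariant P s) (hpq : s(p, q) ∈ s.queue)
    (hX : X ∈ s.part) (hi : i ∈ X) : p ∈ (P i).boundary ∧ segment ℝ p h ⊆ hull P X := by
  obtain ⟨S, hS, T, hTS, hedge⟩ := hinv.hullEdge p q hpq
  obtain ⟨hiT, hpb⟩ := hedge.mem_boundary hdisj hs.source
  -- The part that owns the queued edge contains `i`, so it is `X`.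
  obtain rfl := eq_of_mem_partition hinv.isPartition hS hX (hTS hiT) hi
  refine ⟨hpb, Subset.trans ?_ (hedge.2.subset.trans (hull_mono hTS))⟩
  exact (convex_segment p q).segment_subset (left_mem_segment ℝ p q) hs.mem_segment

/-- The hulls of the set from which the ray was shot and of the set that is hit intersect. -/
theorem hull_inter_nonempty (hdisj : Pairwise fun i j => Disjoint (P i).region (P j).region)
    (hs : Shoots P s p q h i k) (hinv : Invariant P s) (hpq : s(p, q) ∈ s.queue)
    (hX : X ∈ s.part) (hi : i ∈ X) (hX' : X' ∈ s.part) (hk : k ∈ X') :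
    (hull P X ∩ hull P X').Nonempty :=
  ⟨h, (hs.segment_subset_hull hdisj hinv hpq hX hi).2 (right_mem_segment ℝ p h),
    hs.mem_hull (hinv.bridgeableBy X' hX') hk⟩

/-- The polygons that meet the trace belong to the two sets that it joins. -/
theorem mem_of_meets (hdisj : Pairwise fun i j => Disjoint (P i).region (P j).region)
    (hs : Shoots P s p q h i k) (hi : i ∈ X) (hX' : BridgeableBy P X' (s.segmentsOf X'))
    (hk : k ∈ X') {j : ι} (hj : (segment ℝ p h ∩ (P j).region).Nonempty) : j ∈ X ∪ X' := by
  obtain ⟨x, hx, hxj⟩ := hj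
  rw [← insert_endpoints_openSegment] at hx
  rcases hx with rfl | rfl | hx
  · exact Or.inl (index_unique hdisj hs.source hxj ▸ hi)
  · rcases hs.mem_bridged hk with hh | hh
    · obtain ⟨l, hl, hxl⟩ := mem_iUnion₂.1 hh
      exact Or.inr (index_unique hdisj hxl hxj ▸ hl)
    · obtain ⟨b, hb, hxb⟩ := mem_iUnion₂.1 hh
      exact Or.inr (hX'.mem_of_meets b hb j ⟨x, hxb, hxj⟩)
  · exact (disjoint_left.1 hs.clear hx (region_subset_scene s j hxj)).elim

/-- The trace is disjoint from the traces of the sets other than the two that it joins. -/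
theorem disjoint_segment (hs : Shoots P s p q h i k) (hinv : Invariant P s)
    (hX : X ∈ s.part) (hi : i ∈ X) (hX' : X' ∈ s.part) (hk : k ∈ X')
    {T : Set ι} (hT : T ∈ s.part) (hTX : T ≠ X) (hTX' : T ≠ X') {c : Plane × Plane}
    (hc : c ∈ s.segmentsOf T) : Disjoint (segment ℝ p h) (segment ℝ c.1 c.2) := by
  rw [disjoint_left]
  intro x hx hxc
  -- A trace of `T` meets only polygons of `T`, so a common point on a polygon of `X` or `X'` would
  -- identify two different parts.
  have hmem : ∀ j, x ∈ (P j).region → j ∈ T := fun j hj =>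
    (hinv.bridgeableBy T hT).mem_of_meets c hc j ⟨x, hxc, hj⟩
  rw [← insert_endpoints_openSegment] at hx
  rcases hx with rfl | rfl | hx
  · exact hTX (eq_of_mem_partition hinv.isPartition hT hX (hmem i hs.source) hi)
  · rcases hs.mem_bridged hk with hh | hh
    · obtain ⟨l, hl, hxl⟩ := mem_iUnion₂.1 hh
      exact hTX' (eq_of_mem_partition hinv.isPartition hT hX' (hmem l hxl) hl)
    · obtain ⟨b, hb, hxb⟩ := mem_iUnion₂.1 hh
      exact disjoint_left.1 (hinv.disjoint T hT X' hX' hTX' c hc b hb) hxc hxb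
  · exact disjoint_left.1 hs.clear hx (segmentsOf_subset_scene hc hxc)

/-- The traces of two (possibly equal) sets, together with a trace that joins them, bridge the
union. -/
theorem bridgeableBy_union (hdisj : Pairwise fun i j => Disjoint (P i).region (P j).region)
    (hs : Shoots P s p q h i k) (hinv : Invariant P s) (hpq : s(p, q) ∈ s.queue)
    (hX : X ∈ s.part) (hi : i ∈ X) (hX' : X' ∈ s.part) (hk : k ∈ X') :
    BridgeableBy P (X ∪ X') (insert (p, h) (s.segmentsOf (X ∪ X'))) := by
  have bX := hinv.bridgeableBy X hX
  have bX' := hinv.bridgeableBy X' hX'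
  obtain ⟨hpb, hhull⟩ := hs.segment_subset_hull hdisj hinv hpq hX hi
  have hclear : ∀ b ∈ s.segmentsOf (X ∪ X'),
      Disjoint (openSegment ℝ p h) (openSegment ℝ b.1 b.2) := fun b hb =>
    hs.clear.mono_right ((openSegment_subset_segment ℝ _ _).trans (segmentsOf_subset_scene hb))
  have hold := segmentsOf_union s X X'
  refine ⟨?_, ?_, ?_, ?_, ?_, ?_, ?_, ?_⟩
  · rw [hold]
    exact (bX.finite.union bX'.finite).insert _
  · rintro b (rfl | hb)
    · exact hs.ne_source.symm
    · rw [hold] at hb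
      exact hb.elim (bX.nondegenerate b) (bX'.nondegenerate b)
  · rintro b (rfl | hb) c (rfl | hc) hne
    · exact (hne rfl).elim
    · exact hclear c hc
    · exact (hclear b hb).symm
    · rw [hold] at hb hc
      by_cases hXX : X = X'
      · subst hXX
        rw [union_self] at hb hc
        exact bX.interior_disjoint hb hc hne
      have hcross := hinv.disjoint X hX X' hX' hXX
      have hsub := fun b : Plane × Plane => openSegment_subset_segment ℝ b.1 b.2
      rcases hb with hb | hb <;> rcases hc with hc | hc
      · exact bX.interior_disjoint hb hc hne
      · exact (hcross b hb c hc).mono (hsub b) (hsub c)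
      · exact (hcross c hc b hb).symm.mono (hsub b) (hsub c)
      · exact bX'.interior_disjoint hb hc hne
  · have hseg : IsConnected (segment ℝ p h) :=
      ⟨⟨p, left_mem_segment ℝ p h⟩, (convex_segment p h).isPreconnected⟩
    -- The trace is glued to the bridged union of `X` at `p` and to that of `X'` at `h`.
    have h1 := bX.connected.union
      ⟨p, Or.inl (region_subset_polyUnion hi hs.source), left_mem_segment ℝ p h⟩ hseg
    have h2 := h1.union ⟨h, Or.inr (right_mem_segment ℝ p h), hs.mem_bridged hk⟩ bX'.connected
    convert h2 using 1
    rw [polyUnion_union, hold, biUnion_insert, biUnion_union]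
    ext x
    simp only [mem_union]
    tauto
  · rintro b (rfl | hb) j
    · exact hs.clear.mono_right (interior_subset.trans (region_subset_scene s j))
    · rw [hold] at hb
      exact hb.elim (fun hb => bX.interior_disjoint_polygon b hb j)
        (fun hb => bX'.interior_disjoint_polygon b hb j)
  · rintro b (rfl | hb) j hj
    · exact hs.mem_of_meets hdisj hi bX' hk hj
    · rw [hold] at hb
      exact hb.imp (fun hb => bX.mem_of_meets b hb j hj) (fun hb => bX'.mem_of_meets b hb j hj)
  · rintro b (rfl | hb)
    · exact ⟨i, Or.inl hi, Or.inl hpb⟩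
    · rw [hold] at hb
      rcases hb with hb | hb
      · obtain ⟨j, hj, hjb⟩ := bX.endpoint b hb
        exact ⟨j, Or.inl hj, hjb⟩
      · obtain ⟨j, hj, hjb⟩ := bX'.endpoint b hb
        exact ⟨j, Or.inr hj, hjb⟩
  · rintro b (rfl | hb)
    · exact hhull.trans (hull_mono subset_union_left)
    · rw [hold] at hb
      rcases hb with hb | hb
      · exact (bX.subset_hull b hb).trans (hull_mono subset_union_left)
      · exact (bX'.subset_hull b hb).trans (hull_mono subset_union_right)

/-- A ray that joins two (possibly equal) sets of the partition preserves the invariant when these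
are merged. -/
theorem invariant_merge (hdisj : Pairwise fun i j => Disjoint (P i).region (P j).region)
    {rest new : List (Sym2 Plane)} (hs : Shoots P s p q h i k) (hinv : Invariant P s)
    (hqueue : s.queue = s(p, q) :: rest)
    (hX : X ∈ s.part) (hi : i ∈ X) (hX' : X' ∈ s.part) (hk : k ∈ X')
    (hnew : ∀ a b, s(a, b) ∈ new → IsHullEdge (hull P (X ∪ X')) a b) :
    Invariant P ⟨(s.part \ {X, X'}) ∪ {X ∪ X'}, insert ⟨p, h, i⟩ s.traces, rest ++ new⟩ := by
  have hpq : s(p, q) ∈ s.queue := hqueue ▸ List.mem_cons_self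
  have hiU : i ∈ X ∪ X' := Or.inl hi
  -- The new trace has label `i`, so the segments of all parts other than `X` and `X'` are
  -- unchanged.
  have hnotMem : ∀ {S}, S ∈ s.part \ {X, X'} → i ∉ S := fun hS hiS =>
    hS.2 (Or.inl (eq_of_mem_partition hinv.isPartition hS.1 hX hiS hi))
  have hcross : ∀ S ∈ s.part \ {X, X'}, ∀ b ∈ s.segmentsOf S,
      ∀ c ∈ insert (p, h) (s.segmentsOf (X ∪ X')),
      Disjoint (segment ℝ b.1 b.2) (segment ℝ c.1 c.2) := by
    rintro S ⟨hS, hSne⟩ b hb c hc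
    simp only [mem_insert_iff, mem_singleton_iff, not_or] at hSne
    rcases hc with rfl | hc
    · exact (hs.disjoint_segment hinv hX hi hX' hk hS hSne.1 hSne.2 hb).symm
    · rw [segmentsOf_union] at hc
      rcases hc with hc | hc
      · exact hinv.disjoint S hS X hX hSne.1 b hb c hc
      · exact hinv.disjoint S hS X' hX' hSne.2 b hb c hc
  refine ⟨isPartition_merge hinv.isPartition hX hX', ?_, ?_, ?_, ?_⟩
  · rintro S (hS | rfl)
    · exact hinv.tight S hS.1
    · exact (hinv.tight X hX).union (hinv.tight X' hX')
        (hs.hull_inter_nonempty hdisj hinv hpq hX hi hX' hk)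
  · rintro S (hS | rfl)
    · rw [segmentsOf_insert_of_notMem (hnotMem hS)]
      exact hinv.bridgeableBy S hS.1
    · rw [segmentsOf_insert_of_mem hiU]
      exact hs.bridgeableBy_union hdisj hinv hpq hX hi hX' hk
  · rintro S (hS | rfl) T (hT | rfl) hne b hb c hc
    · rw [segmentsOf_insert_of_notMem (hnotMem hS)] at hb
      rw [segmentsOf_insert_of_notMem (hnotMem hT)] at hc
      exact hinv.disjoint S hS.1 T hT.1 hne b hb c hc
    · rw [segmentsOf_insert_of_notMem (hnotMem hS)] at hb
      rw [segmentsOf_insert_of_mem hiU] at hc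
      exact hcross S hS b hb c hc
    · rw [segmentsOf_insert_of_mem hiU] at hb
      rw [segmentsOf_insert_of_notMem (hnotMem hT)] at hc
      exact (hcross T hT c hc b hb).symm
    · exact (hne rfl).elim
  · intro a b hab
    rcases List.mem_append.1 hab with hab | hab
    · obtain ⟨S, hS, T, hTS, hedge⟩ :=
        hinv.hullEdge a b (hqueue ▸ List.mem_cons_of_mem _ hab)
      -- An old edge keeps its `T`; only the part around it may grow to `X ∪ X'`.
      by_cases hSX : S ∈ ({X, X'} : Set (Set ι))
      · refine ⟨X ∪ X', Or.inr rfl, T, hTS.trans ?_, hedge⟩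
        rcases hSX with rfl | rfl
        exacts [subset_union_left, subset_union_right]
      · exact ⟨S, Or.inl ⟨hS, hSX⟩, T, hTS, hedge⟩
    · exact ⟨X ∪ X', Or.inr rfl, X ∪ X', Subset.rfl, hnew a b hab⟩

end Shoots

/-! ### Preservation of the invariant along an execution. -/

namespace Invariant

theorem proper {s : State ι} (h : Invariant P s) : Proper P s.part :=
  ⟨h.isPartition, fun S hS => ⟨h.tight S hS, _, h.bridgeableBy S hS⟩⟩

theorem idleStep (hdisj : Pairwise fun i j => Disjoint (P i).region (P j).region)
    {s s' : State ι} (hinv : Invariant P s) (h : IdleStep P s s') : Invariant P s' := by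
  obtain ⟨p, q, h, i, k, rest, hqueue, hs, ⟨X, hX, hi, hk⟩, rfl⟩ := h
  -- An idle iteration merges `X` with itself and pushes no edges.
  have hmerge := hs.invariant_merge (new := []) hdisj hinv hqueue hX hi hX hk (by simp)
  have hpart : (s.part \ {X, X}) ∪ {X ∪ X} = s.part := by
    rw [pair_eq_singleton, union_self, sdiff_union_of_subset (singleton_subset_iff.2 hX)]
  rwa [hpart, List.append_nil] at hmerge

theorem idleSteps (hdisj : Pairwise fun i j => Disjoint (P i).region (P j).region)
    {s s' : State ι} (hinv : Invariant P s) (h : Relation.ReflTransGen (IdleStep P) s s') :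
    Invariant P s' := by
  induction h with
  | refl => exact hinv
  | tail _ hstep ih => exact ih.idleStep hdisj hstep

theorem mergeStep (hdisj : Pairwise fun i j => Disjoint (P i).region (P j).region)
    {s s' : State ι} {X X' : Set ι} (hinv : Invariant P s) (h : MergeStep P s X X' s') :
    Invariant P s' ∧ (hull P X ∩ hull P X').Nonempty ∧ Compatible P X X' := by
  obtain ⟨p, q, h, i, k, rest, new, hqueue, hs, hX, hX', hi, hk, hne, -, hnew, rfl⟩ := h
  have hpq : s(p, q) ∈ s.queue := hqueue ▸ List.mem_cons_self
  refine ⟨hs.invariant_merge hdisj hinv hqueue hX hi hX' hk fun a b hab => ((hnew a b).1 hab).1,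
    hs.hull_inter_nonempty hdisj hinv hpq hX hi hX' hk, ?_, ?_, ?_⟩
  · exact hinv.isPartition.pairwiseDisjoint hX hX' hne
  · exact ⟨_, _, hinv.bridgeableBy X hX, hinv.bridgeableBy X' hX',
      hinv.disjoint X hX X' hX' hne⟩
  · exact ⟨_, hs.bridgeableBy_union hdisj hinv hpq hX hi hX' hk⟩

end Invariant

theorem Execution.invariant_start
    (hdisj : Pairwise fun i j => Disjoint (P i).region (P j).region) {m : ℕ}
    (E : Execution P m) {t : ℕ} (ht : t ≤ m) : Invariant P (E.start t) := by
  induction t with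
  | zero => exact E.initial.invariant
  | succ t ih =>
    exact (((ih (by omega)).idleSteps hdisj (E.idle t ht)).mergeStep hdisj (E.merge t ht)).1

end Algorithm

end Convexify

open Convexify
theorem mainTheorem6 {ι : Type*} [Finite ι] (P : ι → SimplePolygon)
    (hdisj : Pairwise fun i j => Disjoint (P i).region (P j).region)
    (hgen : GeneralPosition P) (m : ℕ) (E : Execution P m) :
    (∀ t < m,
      (hull P (E.left t) ∩ hull P (E.right t)).Nonempty ∧
      Compatible P (E.left t) (E.right t) ∧
      Proper P (E.partition (t + 1))) ∧
    Proper P (E.partition 0) ∧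
    (∀ t ≤ m, ∀ S ∈ E.partition t, BridgeableBy P S ((E.start t).segmentsOf S)) := by
  refine ⟨fun t ht => ?_, (E.invariant_start hdisj m.zero_le).proper,
    fun t ht => (E.invariant_start hdisj ht).bridgeableBy⟩
  have hfinish := (E.invariant_start hdisj ht.le).idleSteps hdisj (E.idle t ht)
  obtain ⟨hinv, hne, hcomp⟩ := hfinish.mergeStep hdisj (E.merge t ht)
  exact ⟨hne, hcomp, hinv.proper⟩
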